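/- Let $p$ be a prime number, let $K$ be a number field containing a primitive $p$-th root of unity $\zeta$, and let $R=\mathcal{O}_K$ be its ring of integers. Let $C_p$ be a cyclic group of order $p$ with generator $\sigma$, and let $KC_p$ be its group algebra with the usual Hopf algebra structure. A Hopf order of $KC_p$ over $R$ is a finitely generated projective $R$-submodule $X$ of $KC_p$ such that the natural map $X\otimes_R K\to KC_p$ is an isomorphism, $1\in X$, $XX\subseteq X$, $\Delta(X)\subseteq X\otimes_R X$, $\varepsilon(X)\subseteq R$ and $S(X)\subseteq X$. For an ideal $I$ of $R$ containing $\zeta-1$, let $$H(I)=\sum_{i=0}^{p-1} I^i(\zeta-1)^{-i}(\sigma-1)^i\subseteq KC_p$$ be the global Larson order associated to $I$. Then: 1. Every Hopf order of $KC_p$ over $R$ equals $H(I)$ for some ideal $I$ of $R$ containing $\zeta-1$. 2. For every ideal $I$ of $R$ containing $\zeta-1$, the sum defining $H(I)$ is direct, $H(I)$ is a Hopf order of $KC_p$ over $R$, and its $R$-module of integrals $\{t\in H(I) : ht=\varepsilon(h)t \text{ for all } h\in H(I)\}$ equals $\frac{1}{p}I^{p-1}\sum_{i=0}^{p-1}\sigma^i$.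 -/

import Mathlib

open scoped NumberField TensorProduct MonoidAlgebra

noncomputable section

/-- `X` is an order of the `K`-vector space `V` over `R`: a finitely generated projective
`R`-submodule of `V` such that the natural map `K ⊗[R] X → V` is an isomorphism. -/
structure IsVectorSpaceOrder {R : Type*} (K : Type*) {V : Type*} [CommRing R] [Field K]
    [Algebra R K] [AddCommGroup V] [Module K V] [Module R V] [IsScalarTower R K V]
    (X : Submodule R V) : Prop where
  fg : X.FG
  projective : Module.Projective R X
  isBaseChange : IsBaseChange K X.subtype

/-- `X` is a Hopf order over `R` of the `K`-Hopf algebra `H`: an order of `H` which contains `1`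
and is closed under multiplication, comultiplication, counit and antipode. In `comul_mem`, the
`R`-module `X ⊗[R] X` is identified with its image in `H ⊗[K] H`, that is, with the `R`-span of the
tensors `a ⊗ b` with `a, b ∈ X`. -/
structure IsHopfOrder {R : Type*} (K : Type*) {H : Type*} [CommRing R] [Field K]
    [Algebra R K] [Ring H] [HopfAlgebra K H] [Module R H] [IsScalarTower R K H]
    (X : Submodule R H) : Prop extends IsVectorSpaceOrder K X where
  one_mem : (1 : H) ∈ X
  mul_mem : ∀ x ∈ X, ∀ y ∈ X, x * y ∈ X
  comul_mem : ∀ x ∈ X, Coalgebra.comul (R := K) x ∈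
    Submodule.span R {t : H ⊗[K] H | ∃ a ∈ X, ∃ b ∈ X, t = a ⊗ₜ[K] b}
  counit_mem : ∀ x ∈ X, Coalgebra.counit (R := K) x ∈ (algebraMap R K).range
  antipode_mem : ∀ x ∈ X, HopfAlgebra.antipode K x ∈ X

/-- The `R`-submodule of left integrals of an `R`-submodule `X` of a `K`-Hopf algebra `H`: the
`t ∈ X` such that `h * t = ε(h) t` for all `h ∈ X`. -/
def leftIntegrals {R : Type*} (K : Type*) {H : Type*} [CommRing R] [Field K]
    [Algebra R K] [Ring H] [HopfAlgebra K H] [Module R H] [IsScalarTower R K H]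
    (X : Submodule R H) : Submodule R H where
  carrier := {t | t ∈ X ∧ ∀ h ∈ X, h * t = Coalgebra.counit (R := K) h • t}
  zero_mem' := ⟨X.zero_mem, fun h _ => by simp⟩
  add_mem' := fun ha hb => ⟨X.add_mem ha.1 hb.1, fun h hh => by
    rw [mul_add, ha.2 h hh, hb.2 h hh, smul_add]⟩
  smul_mem' := fun r t ht => ⟨X.smul_mem r ht.1, fun h hh => by
    rw [← algebraMap_smul K r t, mul_smul_comm, ht.2 h hh, smul_comm]⟩

/-- The `R`-submodule `I v = {r v : r ∈ I}` for an ideal `I` of `R` and a vector `v`. -/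
def idealSMulVec {R V : Type*} [CommRing R] [AddCommGroup V] [Module R V]
    (I : Ideal R) (v : V) : Submodule R V :=
  Submodule.map (LinearMap.toSpanSingleton R V v) I

section Larson

variable {K : Type*} [Field K] {G : Type*} [Group G]

/-- The summand `I ^ i (ζ - 1) ^ (-i) (σ - 1) ^ i` of the global Larson order, inside `K[G]`. -/
def larsonSummand (ζ : K) (σ : G) (I : Ideal (𝓞 K)) (i : ℕ) : Submodule (𝓞 K) K[G] :=
  idealSMulVec (I ^ i) (((ζ - 1) ^ i)⁻¹ • (MonoidAlgebra.of K G σ - 1) ^ i)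

/-- The global Larson order `H(I) = ⊕ I ^ i (ζ - 1) ^ (-i) (σ - 1) ^ i`, where `0 ≤ i ≤ p - 1`.
Here it is the sum of the summands; that the sum is direct is a separate assertion. -/
def globalLarsonOrder (p : ℕ) (ζ : K) (σ : G) (I : Ideal (𝓞 K)) : Submodule (𝓞 K) K[G] :=
  ⨆ i : Fin p, larsonSummand ζ σ I i

end Larson

end

/-!
Fix a character `χ` of the cyclic group with `χ(σ) = ζ`. An element `x` of `K[G]` is recorded by
the sequence `f(j) = (χ ^ j)(x)`, which is `p`-periodic and determines `x` (`charTransform_ext`). In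
these terms `(σ - 1) / (ζ - 1)` becomes the sequence of `q`-integers
`[j] = 1 + ζ + ⋯ + ζ ^ (j - 1)`, whose differences `[k] - [m]` are units of `R` for `k ≢ m` mod `p`.

Everything is compared with one intermediate object: `newtonOrder χ I`, the module of those `x` for
which the `i`-th forward differences of `f` lie in `I ^ i` for all `i`. By the Leibniz rule it is a
ring. By Newton interpolation (`eq_newtonOrder_of_exists`), a submodule `X` of `newtonOrder χ I` is
the whole of it once, for each `k < p` and `c ∈ I ^ k`, it contains an element whose sequence
vanishes at `0, …, k - 1` and equals `c` at `k`.

* For `H(I)` such elements are the Lagrange polynomials in `(σ - 1) / (ζ - 1)` with nodes `[m]`, so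
  `H(I) = newtonOrder χ I` (`larsonOrder_eq_newtonOrder`). In particular `H(I)` is a ring containing
  `σ`, and its stability under the coproduct and the antipode needs checking only on the elements
  `c (σ - 1) / (ζ - 1)` for `c ∈ I`.
* For a Hopf order `X`, let `I` be the ideal of the values `f(1) - f(0)`. Taking the difference of
  `f` is convolution with `χ - ε`, so `Δ(X) ⊆ X ⊗ X` shows that it maps `X` into `I X`; hence
  `X ⊆ newtonOrder χ I` (`IsHopfOrder.le_newtonOrder`). For the same reason `X` is stable under
  translation, and since `p` is prime all differences `f(k) - f(m)` with `k ≢ m` fill the same ideal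
  `I`; products of elements vanishing at one point each give the elements needed for interpolation.
  So `X = newtonOrder χ I = H(I)`. That `ζ - 1` is in `I` follows from `σ ∈ X`, which holds because
  the functionals in the dual of `X` take integral values at group elements (`IsHopfOrder.of_mem`).
* An integral of `H(I)` has a sequence supported at `0` modulo `p`, and then its `(p - 1)`-st
  difference at `1` is its value at `0`, which therefore lies in `I ^ (p - 1)`
  (`leftIntegrals_larsonOrder`).

The argument works over any Dedekind domain `R` with fraction field `K` containing a primitive
`p`-th root of unity; there is no need to localize or complete.
-/

/-! ### Characters as sequences -/

section Fourier

variable {K : Type*} [Field K] {G : Type*} [Group G]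

/-- The transform attached to a character `χ` of `G`: an element `x` of `K[G]` becomes the function
`j ↦ (χ ^ j)(x)`. The exponents run over `ℕ`, so that the transform is a `p`-periodic sequence when
`χ ^ p = 1`, and the calculus of forward differences applies to it. -/
noncomputable def charTransform (χ : G →* K) : K[G] →ₐ[K] (ℕ → K) :=
  MonoidAlgebra.lift K (ℕ → K) G
    { toFun := fun g j => χ g ^ j
      map_one' := by ext; simp
      map_mul' := fun a b => by ext; simp [mul_pow] }

@[simp]
theorem charTransform_single (χ : G →* K) (g : G) (a : K) (j : ℕ) :
    charTransform χ (MonoidAlgebra.single g a) j = a * χ g ^ j := by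
  simp [charTransform]

@[simp]
theorem charTransform_of (χ : G →* K) (g : G) (j : ℕ) :
    charTransform χ (MonoidAlgebra.of K G g) j = χ g ^ j := by
  simp [MonoidAlgebra.of_apply]

theorem charTransform_zero_eq_counit (χ : G →* K) (x : K[G]) :
    charTransform χ x 0 = Coalgebra.counit (R := K) x := by
  induction x using MonoidAlgebra.induction_linear with
  | zero => simp
  | add x y hx hy => simp [hx, hy]
  | single g a => simp

end Fourier

section Prime

variable {p : ℕ} {K : Type*} [Field K] {G : Type*} [Group G]

theorem exists_character_of_generator [NeZero p] {ζ : K} (hζ : IsPrimitiveRoot ζ p)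
    (hG : Nat.card G = p) {σ : G} (hσ : ∀ g : G, g ∈ Subgroup.zpowers σ) :
    ∃ χ : G →* K, χ σ = ζ := by
  have ho : orderOf σ = p := by rw [orderOf_eq_card_of_forall_mem_zpowers hσ, hG]
  let u : Kˣ := hζ.toRootsOfUnity
  have hu : (u : K) = ζ := rfl
  have h1 : orderOf u ∣ orderOf σ := by
    rw [ho]
    apply orderOf_dvd_of_pow_eq_one
    ext
    simp [hu, hζ.pow_eq_one]
  exact ⟨(Units.coeHom K).comp (monoidHomOfForallMemZpowers hσ h1), by simp [hu]⟩

theorem exists_pow_eq_of_generator [NeZero p] (hG : Nat.card G = p) {σ : G}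
    (hσ : ∀ g : G, g ∈ Subgroup.zpowers σ) (g : G) : ∃ n : ℕ, σ ^ n = g := by
  have : Finite G := Nat.finite_of_card_ne_zero (hG ▸ NeZero.ne p)
  exact mem_powers_iff_mem_zpowers.mpr (hσ g)

theorem charTransform_periodic [NeZero p] (hG : Nat.card G = p) (χ : G →* K) (x : K[G]) (j n : ℕ) :
    charTransform χ x (j + p * n) = charTransform χ x j := by
  have hp (g : G) : χ g ^ p = 1 := by rw [← map_pow, ← hG, pow_card_eq_one', map_one]
  induction x using MonoidAlgebra.induction_linear with
  | zero => simp
  | add x y hx hy => simp [hx, hy]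
  | single g a => simp [pow_add, pow_mul, hp]

theorem charTransform_antipode [NeZero p] (hG : Nat.card G = p) (χ : G →* K) (x : K[G]) (j : ℕ) :
    charTransform χ (HopfAlgebra.antipode K x) j = charTransform χ x ((p - 1) * j) := by
  have hp (g : G) : χ g⁻¹ = χ g ^ (p - 1) := by
    rw [← map_pow]
    congr 1
    rw [inv_eq_iff_mul_eq_one, mul_pow_sub_one (NeZero.ne p), ← hG, pow_card_eq_one']
  induction x using MonoidAlgebra.induction_linear with
  | zero => simp
  | add x y hx hy => simp [hx, hy]
  | single g a => simp [hp, ← pow_mul]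

/-- Fourier inversion in the form needed here: an element of `K[G]` is determined by the values of
its characters. -/
theorem charTransform_ext [NeZero p] {ζ : K} (hζ : IsPrimitiveRoot ζ p) (hG : Nat.card G = p)
    {σ : G} (hσ : ∀ g : G, g ∈ Subgroup.zpowers σ) {χ : G →* K} (hχ : χ σ = ζ) {x y : K[G]}
    (h : ∀ j < p, charTransform χ x j = charTransform χ y j) : x = y := by
  rw [← sub_eq_zero]
  replace h : ∀ j < p, charTransform χ (x - y) j = 0 := fun j hj => by simp [h j hj]
  generalize x - y = z at h
  -- `z` is a polynomial in `σ`, of degree `< p` after reduction modulo `X ^ p - 1`.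
  obtain ⟨P, rfl⟩ : ∃ P : Polynomial K, Polynomial.aeval (MonoidAlgebra.of K G σ) P = z := by
    clear h
    induction z using MonoidAlgebra.induction_linear with
    | zero => exact ⟨0, by simp⟩
    | add x y hx hy =>
      obtain ⟨P, rfl⟩ := hx
      obtain ⟨Q, rfl⟩ := hy
      exact ⟨P + Q, by simp⟩
    | single g a =>
      obtain ⟨n, rfl⟩ := exists_pow_eq_of_generator hG hσ g
      refine ⟨Polynomial.monomial n a, ?_⟩
      rw [Polynomial.aeval_monomial, ← map_pow, MonoidAlgebra.of_apply, ← Algebra.smul_def]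
      simp
  have hm : (Polynomial.X ^ p - 1 : Polynomial K).Monic :=
    Polynomial.monic_X_pow_sub_C (1 : K) (NeZero.ne p)
  have ho : σ ^ p = 1 := by rw [← hG, pow_card_eq_one']
  have hz : Polynomial.aeval (MonoidAlgebra.of K G σ) P =
      Polynomial.aeval (MonoidAlgebra.of K G σ) (P %ₘ (Polynomial.X ^ p - 1)) := by
    conv_lhs => rw [← Polynomial.modByMonic_add_div P (Polynomial.X ^ p - 1)]
    rw [map_add, map_mul]
    simp only [map_sub, map_pow, Polynomial.aeval_X, map_one]
    rw [← map_pow, ho, map_one, sub_self, zero_mul, add_zero]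
  rw [hz] at h ⊢
  classical
  suffices P %ₘ (Polynomial.X ^ p - 1) = 0 by rw [this, map_zero]
  refine Polynomial.eq_zero_of_degree_lt_of_eval_finset_eq_zero
    ((Finset.range p).image fun j => ζ ^ j) ?_ ?_
  · rw [Finset.card_image_of_injOn, Finset.card_range]
    · refine (Polynomial.degree_modByMonic_lt _ hm).trans_eq ?_
      exact Polynomial.degree_X_pow_sub_C (Nat.pos_of_neZero p) (1 : K)
    · intro i hi j hj hij
      exact hζ.pow_inj (by simpa using hi) (by simpa using hj) hij
  · intro a ha
    obtain ⟨j, hj, rfl⟩ := Finset.mem_image.mp ha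
    have := h j (Finset.mem_range.mp hj)
    rw [show ∀ y, charTransform χ y j =
      ((Pi.evalAlgHom K (fun _ : ℕ => K) j).comp (charTransform χ)) y from fun _ => rfl,
      ← Polynomial.aeval_algHom_apply, Polynomial.aeval_def] at this
    simpa [hχ, Polynomial.eval₂_eq_eval_map] using this

end Prime

/-! ### The difference filtration -/

section Differences

variable {R K : Type*} [CommRing R] [Field K] [Algebra R K]

/-- The image in `K` of the power `I ^ n` of an ideal `I` of `R`. -/
noncomputable def powImage (I : Ideal R) (n : ℕ) : Submodule R K :=
  Submodule.map (Algebra.linearMap R K) (I ^ n)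

variable {I : Ideal R}

theorem exists_of_mem_powImage {a : K} {n : ℕ} (h : a ∈ powImage I n) :
    ∃ c ∈ I ^ n, algebraMap R K c = a := h

theorem algebraMap_mem_powImage_zero (c : R) : algebraMap R K c ∈ powImage I 0 :=
  ⟨c, by simp, rfl⟩

theorem mul_mem_powImage {a b : K} {m n : ℕ} (ha : a ∈ powImage I m) (hb : b ∈ powImage I n) :
    a * b ∈ powImage I (m + n) := by
  obtain ⟨c, hc, rfl⟩ := ha
  obtain ⟨d, hd, rfl⟩ := hb
  exact ⟨c * d, by simpa [pow_add] using Ideal.mul_mem_mul hc hd, by simp⟩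

theorem powImage_antitone {m n : ℕ} (h : m ≤ n) : (powImage I n : Submodule R K) ≤ powImage I m :=
  Submodule.map_mono (Ideal.pow_le_pow_right h)

/-- The sequence `f` lies in step `n` of the difference filtration attached to `I`: the values of
its `i`-th differences lie in `I ^ (i + n)` for all `i`. -/
def DiffBounded (I : Ideal R) (n : ℕ) (f : ℕ → K) : Prop :=
  ∀ i j, (fwdDiff 1)^[i] f j ∈ powImage I (i + n)

variable {f g : ℕ → K} {m n : ℕ}

theorem DiffBounded.add (hf : DiffBounded I n f) (hg : DiffBounded I n g) :
    DiffBounded I n (f + g) := fun i j => by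
  rw [fwdDiff_iter_add]
  exact add_mem (hf i j) (hg i j)

theorem DiffBounded.smul (c : R) (hf : DiffBounded I n f) :
    DiffBounded I n (c • f) := fun i j => by
  rw [fwdDiff_iter_const_smul]
  exact Submodule.smul_mem _ c (hf i j)

theorem diffBounded_iff :
    DiffBounded I n f ↔ (∀ j, f j ∈ powImage I n) ∧ DiffBounded I (n + 1) (fwdDiff 1 f) := by
  constructor
  · refine fun h => ⟨fun j => by simpa using h 0 j, fun i j => ?_⟩
    rw [← Function.iterate_succ_apply, ← Nat.add_assoc, Nat.add_right_comm]
    exact h (i + 1) j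
  · rintro ⟨h0, h⟩ (_ | i) j
    · simpa using h0 j
    · rw [Function.iterate_succ_apply, Nat.add_right_comm]
      exact h i j

/-- The difference filtration is multiplicative, by the Leibniz rule
`Δ(f g) = Δ(f) g + f Δ(g) + Δ(f) Δ(g)`. -/
theorem DiffBounded.mul (hf : DiffBounded I m f) (hg : DiffBounded I n g) :
    DiffBounded I (m + n) (f * g) := by
  intro i
  induction i generalizing m n f g with
  | zero =>
    intro j
    simpa using mul_mem_powImage (by simpa using hf 0 j) (by simpa using hg 0 j)
  | succ i ih =>
    intro j
    have hL : fwdDiff 1 (f * g) =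
        fwdDiff 1 f * g + f * fwdDiff 1 g + fwdDiff 1 f * fwdDiff 1 g := by
      ext j
      simp only [fwdDiff, Pi.mul_apply, Pi.add_apply]
      ring
    have hf' := (diffBounded_iff.mp hf).2
    have hg' := (diffBounded_iff.mp hg).2
    rw [Function.iterate_succ_apply, hL, fwdDiff_iter_add, fwdDiff_iter_add]
    refine add_mem (add_mem ?_ ?_) ?_
    · exact powImage_antitone (by omega) (ih hf' hg j)
    · exact powImage_antitone (by omega) (ih hf hg' j)
    · exact powImage_antitone (by omega) (ih hf' hg' j)

theorem fwdDiff_iter_geom (q : K) (i j : ℕ) :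
    (fwdDiff 1)^[i] (fun j => q ^ j) j = (q - 1) ^ i * q ^ j := by
  induction i generalizing j with
  | zero => simp
  | succ i ih =>
    rw [Function.iterate_succ_apply', fwdDiff, ih, ih]
    ring

/-- A sequence vanishing at `k, …, k + n - 1` has `n`-th difference at `k` equal to its value at
`k + n`. -/
theorem fwdDiff_iter_eq_of_forall_eq_zero {k n : ℕ} (h : ∀ i < n, f (k + i) = 0) :
    (fwdDiff 1)^[n] f k = f (k + n) := by
  rw [fwdDiff_iter_eq_sum_shift, Finset.sum_range_succ, Finset.sum_eq_zero]
  · simp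
  · intro i hi
    simp [h i (Finset.mem_range.mp hi)]

end Differences

section NewtonOrder

variable {p : ℕ} {R K : Type*} [CommRing R] [Field K] [Algebra R K] {G : Type*} [Group G]

theorem charTransform_integer_smul (χ : G →* K) (c : R) (x : K[G]) :
    charTransform χ (c • x) = c • charTransform χ x := by
  rw [← algebraMap_smul K c x, map_smul, algebraMap_smul]

theorem charTransform_integer_smul_apply (χ : G →* K) (c : R) (x : K[G]) (j : ℕ) :
    charTransform χ (c • x) j = algebraMap R K c * charTransform χ x j := by
  rw [charTransform_integer_smul, Pi.smul_apply, Algebra.smul_def]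

/-- The `R`-submodule of those `x ∈ K[G]` for which the `i`-th differences of the sequence
`j ↦ (χ ^ j)(x)` take values in `I ^ i`. -/
noncomputable def newtonOrder (χ : G →* K) (I : Ideal R) : Submodule R K[G] where
  carrier := {x | DiffBounded I 0 (charTransform χ x)}
  zero_mem' := fun i j => by
    have : (fwdDiff 1)^[i] (0 : ℕ → K) = 0 := by
      rw [← fwdDiff_aux.coe_fwdDiffₗ_pow, map_zero]
    simp [this]
  add_mem' := fun hx hy => by
    simpa using hx.add hy
  smul_mem' := fun c x hx => by
    simpa [charTransform_integer_smul] using DiffBounded.smul c hx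

variable {χ : G →* K} {I : Ideal R}

theorem mem_newtonOrder {x : K[G]} :
    x ∈ newtonOrder χ I ↔ DiffBounded I 0 (charTransform χ x) := Iff.rfl

theorem mul_mem_newtonOrder {x y : K[G]} (hx : x ∈ newtonOrder χ I) (hy : y ∈ newtonOrder χ I) :
    x * y ∈ newtonOrder χ I := by
  rw [mem_newtonOrder, map_mul]
  exact DiffBounded.mul hx hy

theorem charTransform_mem_of_mem_newtonOrder {x : K[G]} (hx : x ∈ newtonOrder χ I) (j : ℕ) :
    ∃ c : R, algebraMap R K c = charTransform χ x j := by
  obtain ⟨c, -, hc⟩ := hx 0 j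
  exact ⟨c, hc⟩

/-- Newton interpolation: a submodule of `newtonOrder χ I` is everything as soon as it contains, for
each `k < p` and each `c ∈ I ^ k`, an element vanishing at `0, …, k - 1` and taking the value `c` at
`k`. Indeed the value at `k` of an element of `newtonOrder χ I` vanishing at `0, …, k - 1` is its
`k`-th difference at `0`, so it lies in `I ^ k` and can be removed. -/
theorem eq_newtonOrder_of_exists [NeZero p] {ζ : K} (hζ : IsPrimitiveRoot ζ p)
    (hG : Nat.card G = p) {σ : G} (hσ : ∀ g : G, g ∈ Subgroup.zpowers σ) (hχ : χ σ = ζ)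
    {X : Submodule R K[G]} (hX : X ≤ newtonOrder χ I)
    (h : ∀ k < p, ∀ c ∈ I ^ k, ∃ x ∈ X, (∀ j < k, charTransform χ x j = 0) ∧
      charTransform χ x k = algebraMap R K c) : X = newtonOrder χ I := by
  refine le_antisymm hX fun y hy => ?_
  have key : ∀ k ≤ p, ∃ x ∈ X, ∀ j < k, charTransform χ (y - x) j = 0 := by
    intro k
    induction k with
    | zero => exact fun _ => ⟨0, X.zero_mem, by simp⟩
    | succ k ih =>
      intro hk
      obtain ⟨x, hx, hxj⟩ := ih (by omega)
      have hd := (sub_mem hy (hX hx) : y - x ∈ newtonOrder χ I) k 0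
      rw [fwdDiff_iter_eq_of_forall_eq_zero (by simpa using hxj)] at hd
      obtain ⟨c, hc, hck⟩ := exists_of_mem_powImage hd
      obtain ⟨z, hz, hzj, hzk⟩ := h k (by omega) c (by simpa using hc)
      refine ⟨x + z, add_mem hx hz, fun j hj => ?_⟩
      rw [← sub_sub, map_sub, Pi.sub_apply]
      rcases (Nat.lt_succ_iff_lt_or_eq.mp hj) with hj | rfl
      · rw [hxj j hj, hzj j hj, sub_zero]
      · rw [hzk, hck, zero_add, sub_self]
  obtain ⟨x, hx, hxj⟩ := key p le_rfl
  have : y = x := charTransform_ext hζ hG hσ hχ fun j hj => by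
    simpa [sub_eq_zero] using hxj j hj
  exact this ▸ hx

end NewtonOrder

/-! ### Larson orders as difference orders -/

section Larson

variable {p : ℕ} {R K : Type*} [CommRing R] [Field K] [Algebra R K] {G : Type*} [Group G]

/-- The element `(σ - 1) / (ζ - 1)` of `K[G]`. -/
noncomputable def larsonGenerator (ζ : K) (σ : G) : K[G] :=
  (ζ - 1)⁻¹ • (MonoidAlgebra.of K G σ - 1)

/-- The Larson order over a domain `R` with fraction field `K`: the sum of the submodules
`I ^ i ((σ - 1) / (ζ - 1)) ^ i` for `0 ≤ i < p`. -/
noncomputable def larsonOrder (p : ℕ) (ζ : K) (σ : G) (I : Ideal R) : Submodule R K[G] :=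
  ⨆ i : Fin p, idealSMulVec (I ^ (i : ℕ)) (larsonGenerator ζ σ ^ (i : ℕ))

theorem pow_smul_pow_mem {A : Type*} [Ring A] [Algebra R A] {M : Submodule R A} (h1 : 1 ∈ M)
    (hmul : ∀ x ∈ M, ∀ y ∈ M, x * y ∈ M) {I : Ideal R} {g : A} (hg : ∀ c ∈ I, c • g ∈ M)
    (n : ℕ) : ∀ c ∈ I ^ n, c • g ^ n ∈ M := by
  induction n with
  | zero => exact fun c _ => by simpa using M.smul_mem c h1
  | succ n ih =>
    intro c hc
    rw [pow_succ] at hc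
    refine Submodule.mul_induction_on hc (fun a ha b hb => ?_) fun a b ha hb => ?_
    · rw [pow_succ, ← smul_mul_smul_comm]
      exact hmul _ (ih a ha) _ (hg b hb)
    · rw [add_smul]
      exact add_mem ha hb

theorem larsonGenerator_smul_pow_mem {I : Ideal R} {ζ : K} {σ : G} {i : ℕ} (hi : i < p) {c : R}
    (hc : c ∈ I ^ i) : c • larsonGenerator ζ σ ^ i ∈ larsonOrder p ζ σ I :=
  Submodule.mem_iSup_of_mem (⟨i, hi⟩ : Fin p) ⟨c, hc, rfl⟩

theorem larsonOrder_le_iff {I : Ideal R} {ζ : K} {σ : G} {M : Submodule R K[G]} :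
    larsonOrder p ζ σ I ≤ M ↔ ∀ i < p, ∀ c ∈ I ^ i, c • larsonGenerator ζ σ ^ i ∈ M := by
  refine ⟨fun h i hi c hc => h (larsonGenerator_smul_pow_mem hi hc), fun h => iSup_le fun i => ?_⟩
  rintro _ ⟨c, hc, rfl⟩
  exact h i i.2 c hc

variable [Fact p.Prime] {ζ : R}

theorem algebraMap_sub_one_ne_zero [FaithfulSMul R K] (hζ : IsPrimitiveRoot ζ p) :
    algebraMap R K ζ - 1 ≠ 0 :=
  sub_ne_zero.mpr <| (hζ.map_of_injective (FaithfulSMul.algebraMap_injective R K)).ne_one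
    (Fact.out : p.Prime).one_lt

theorem charTransform_smul_pow_sub_one [FaithfulSMul R K] (hζ : IsPrimitiveRoot ζ p)
    {σ : G} {χ : G →* K} (hχ : χ σ = algebraMap R K ζ) (s j : ℕ) :
    charTransform χ ((algebraMap R K ζ - 1)⁻¹ • (MonoidAlgebra.of K G (σ ^ s) - 1)) j =
      algebraMap R K (∑ i ∈ Finset.range (s * j), ζ ^ i) := by
  rw [map_smul, Pi.smul_apply, map_sub, Pi.sub_apply, charTransform_of, map_one, Pi.one_apply,
    map_pow, hχ, ← pow_mul, smul_eq_mul, inv_mul_eq_iff_eq_mul₀ (algebraMap_sub_one_ne_zero hζ),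
    ← map_pow, ← map_one (algebraMap R K), ← map_sub, ← map_sub, ← map_mul, mul_geom_sum]

theorem charTransform_larsonGenerator [FaithfulSMul R K] (hζ : IsPrimitiveRoot ζ p)
    {σ : G} {χ : G →* K} (hχ : χ σ = algebraMap R K ζ) (j : ℕ) :
    charTransform χ (larsonGenerator (algebraMap R K ζ) σ) j =
      algebraMap R K (∑ i ∈ Finset.range j, ζ ^ i) := by
  simpa [larsonGenerator] using charTransform_smul_pow_sub_one hζ hχ 1 j

/-- The differences `[k] - [m]` of `q`-integers at `q = ζ` are units for `k ≢ m` modulo `p`. -/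
theorem isUnit_geom_sum_sub_geom_sum [IsDomain R] (hζ : IsPrimitiveRoot ζ p) {k m : ℕ}
    (hk : k < p) (hm : m < p) (h : k ≠ m) :
    IsUnit (∑ i ∈ Finset.range k, ζ ^ i - ∑ i ∈ Finset.range m, ζ ^ i) := by
  have key : ∀ {k m : ℕ}, k < p → m < k →
      IsUnit (∑ i ∈ Finset.range k, ζ ^ i - ∑ i ∈ Finset.range m, ζ ^ i) := by
    intro k m hk hm
    obtain ⟨a, rfl⟩ := Nat.exists_eq_add_of_le hm.le
    rw [Finset.sum_range_add, add_sub_cancel_left]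
    simp only [pow_add]
    rw [← Finset.mul_sum]
    refine ((hζ.isUnit (Fact.out : p.Prime).ne_zero).pow m).mul
      (hζ.geom_sum_isUnit (Fact.out : p.Prime).two_le ?_)
    exact (Nat.coprime_of_lt_prime (by omega) (by omega) (Fact.out : p.Prime)).symm
  rcases lt_or_gt_of_ne h with h | h
  · rw [← neg_sub, IsUnit.neg_iff]
    exact key hm h
  · exact key hk h

theorem diffBounded_geom {I : Ideal R} {a q : R} {n : ℕ} (ha : a ∈ I ^ n) (hq : q - 1 ∈ I) :
    DiffBounded I n (fun j => algebraMap R K (a * q ^ j)) := by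
  have h : (fun j => algebraMap R K (a * q ^ j)) = a • fun j => algebraMap R K q ^ j := by
    ext j
    simp [Algebra.smul_def]
  intro i j
  rw [h, fwdDiff_iter_const_smul, Pi.smul_apply, fwdDiff_iter_geom]
  refine ⟨a * ((q - 1) ^ i * q ^ j), ?_, by simp [Algebra.smul_def]⟩
  rw [add_comm i n, pow_add, ← mul_assoc]
  exact Ideal.mul_mem_right _ _ (Ideal.mul_mem_mul ha (Ideal.pow_mem_pow hq i))

theorem pow_sub_one_mem {I : Ideal R} (hI : ζ - 1 ∈ I) (s : ℕ) : ζ ^ s - 1 ∈ I :=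
  I.mem_of_dvd (by simpa using sub_dvd_pow_sub_pow ζ 1 s) hI

variable {I : Ideal R} {σ : G} {χ : G →* K}

theorem of_pow_mem_newtonOrder (hχ : χ σ = algebraMap R K ζ) (hI : ζ - 1 ∈ I) (s : ℕ) :
    MonoidAlgebra.of K G (σ ^ s) ∈ newtonOrder χ I := by
  have h := diffBounded_geom (K := K) (I := I) (n := 0) (a := 1) (by simp) (pow_sub_one_mem hI s)
  have e : charTransform χ (MonoidAlgebra.of K G (σ ^ s)) =
      fun j => algebraMap R K (1 * (ζ ^ s) ^ j) := by
    ext j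
    rw [charTransform_of, map_pow, hχ, one_mul, map_pow, map_pow]
  rwa [mem_newtonOrder, e]

theorem smul_pow_sub_one_mem_newtonOrder [FaithfulSMul R K] (hζ : IsPrimitiveRoot ζ p)
    (hχ : χ σ = algebraMap R K ζ) (hI : ζ - 1 ∈ I) (s : ℕ) {c : R} (hc : c ∈ I) :
    c • (algebraMap R K ζ - 1)⁻¹ • (MonoidAlgebra.of K G (σ ^ s) - 1) ∈ newtonOrder χ I := by
  have h : charTransform χ (c • (algebraMap R K ζ - 1)⁻¹ • (MonoidAlgebra.of K G (σ ^ s) - 1)) =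
      fun j => algebraMap R K (c * ∑ i ∈ Finset.range (s * j), ζ ^ i) := by
    ext j
    rw [charTransform_integer_smul_apply, charTransform_smul_pow_sub_one hζ hχ, map_mul]
  rw [mem_newtonOrder, h, diffBounded_iff]
  refine ⟨fun j => algebraMap_mem_powImage_zero _, ?_⟩
  have hd : fwdDiff 1 (fun j => algebraMap R K (c * ∑ i ∈ Finset.range (s * j), ζ ^ i)) =
      fun j => algebraMap R K ((c * ∑ i ∈ Finset.range s, ζ ^ i) * (ζ ^ s) ^ j) := by
    ext j
    rw [fwdDiff, ← map_sub, ← mul_sub, Nat.mul_succ, Finset.sum_range_add, add_sub_cancel_left,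
      mul_assoc, Finset.sum_mul]
    simp only [pow_add, pow_mul, mul_comm]
  rw [hd]
  exact diffBounded_geom (by simpa using Ideal.mul_mem_right _ _ hc) (pow_sub_one_mem hI s)

theorem one_mem_newtonOrder : (1 : K[G]) ∈ newtonOrder χ I := by
  have h := diffBounded_geom (K := K) (I := I) (n := 0) (a := 1) (q := 1) (by simp) (by simp)
  have e : (1 : ℕ → K) = fun j => algebraMap R K (1 * 1 ^ j) := by
    ext j
    simp
  rwa [mem_newtonOrder, map_one, e]

theorem larsonOrder_le_newtonOrder [FaithfulSMul R K] (hζ : IsPrimitiveRoot ζ p)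
    (hχ : χ σ = algebraMap R K ζ) (hI : ζ - 1 ∈ I) :
    larsonOrder p (algebraMap R K ζ) σ I ≤ newtonOrder χ I := by
  refine larsonOrder_le_iff.mpr fun i _ => ?_
  have hg (c : R) (hc : c ∈ I) : c • larsonGenerator (algebraMap R K ζ) σ ∈ newtonOrder χ I := by
    have := smul_pow_sub_one_mem_newtonOrder hζ hχ hI 1 hc
    rwa [pow_one] at this
  have hm : ∀ x ∈ newtonOrder χ I, ∀ y ∈ newtonOrder χ I, x * y ∈ newtonOrder χ I :=
    fun x hx y hy => mul_mem_newtonOrder hx hy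
  exact pow_smul_pow_mem one_mem_newtonOrder hm hg i

/-- Lagrange interpolation at the nodes `[m]`, whose differences are units: the polynomial in
`(σ - 1) / (ζ - 1)` with roots `[m]` for `m ∈ s`, scaled to take the value `c` at `k`. -/
theorem exists_mem_larsonOrder [IsDomain R] [FaithfulSMul R K] (hζ : IsPrimitiveRoot ζ p)
    (hχ : χ σ = algebraMap R K ζ) {s : Finset ℕ} (hs : ∀ m ∈ s, m < p) (hsp : s.card < p) {k : ℕ}
    (hk : k < p) (hks : k ∉ s) {c : R} (hc : c ∈ I ^ s.card) :
    ∃ x ∈ larsonOrder p (algebraMap R K ζ) σ I, (∀ j ∈ s, charTransform χ x j = 0) ∧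
      charTransform χ x k = algebraMap R K c := by
  let P : Polynomial R :=
    ∏ m ∈ s, (Polynomial.X - Polynomial.C (∑ i ∈ Finset.range m, ζ ^ i))
  have hu : IsUnit (P.eval (∑ i ∈ Finset.range k, ζ ^ i)) := by
    simp only [P, Polynomial.eval_prod, Polynomial.eval_sub, Polynomial.eval_X, Polynomial.eval_C]
    exact IsUnit.prod_iff.mpr fun m hm =>
      isUnit_geom_sum_sub_geom_sum hζ hk (hs m hm) fun h => hks (h ▸ hm)
  have hdeg : P.natDegree = s.card := Polynomial.natDegree_finsetProd_X_sub_C_eq_card s _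
  have hval (d : R) (j : ℕ) : charTransform χ
      (d • Polynomial.aeval (larsonGenerator (algebraMap R K ζ) σ) P) j =
      algebraMap R K (d * P.eval (∑ i ∈ Finset.range j, ζ ^ i)) := by
    rw [charTransform_integer_smul_apply, map_mul]
    congr 1
    change (((Pi.evalAlgHom K (fun _ : ℕ => K) j).comp (charTransform χ)).restrictScalars R)
      (Polynomial.aeval _ P) = _
    rw [← Polynomial.aeval_algHom_apply, ← Polynomial.coe_aeval_eq_eval,
      ← Polynomial.aeval_algebraMap_apply]
    congr 2
    exact charTransform_larsonGenerator hζ hχ j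
  refine ⟨(c * ↑hu.unit⁻¹) • Polynomial.aeval (larsonGenerator (algebraMap R K ζ) σ) P, ?_, ?_, ?_⟩
  · rw [Polynomial.aeval_eq_sum_range, Finset.smul_sum, hdeg]
    refine sum_mem fun i hi => ?_
    have hi' : i ≤ s.card := Nat.lt_succ_iff.mp (Finset.mem_range.mp hi)
    rw [smul_smul]
    exact larsonGenerator_smul_pow_mem (hi'.trans_lt hsp) (Ideal.mul_mem_right _ _
      (Ideal.mul_mem_right _ _ (Ideal.pow_le_pow_right hi' hc)))
  · intro j hj
    have : P.eval (∑ i ∈ Finset.range j, ζ ^ i) = 0 := by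
      simp only [P, Polynomial.eval_prod]
      exact Finset.prod_eq_zero hj (by rw [Polynomial.eval_sub, Polynomial.eval_X,
        Polynomial.eval_C, sub_self])
    rw [hval, this, mul_zero, map_zero]
  · rw [hval, mul_assoc, IsUnit.val_inv_mul, mul_one]

theorem larsonOrder_eq_newtonOrder [IsDomain R] [FaithfulSMul R K] (hζ : IsPrimitiveRoot ζ p)
    (hG : Nat.card G = p) (hσ : ∀ g : G, g ∈ Subgroup.zpowers σ)
    (hχ : χ σ = algebraMap R K ζ) (hI : ζ - 1 ∈ I) :
    larsonOrder p (algebraMap R K ζ) σ I = newtonOrder χ I := by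
  have : NeZero p := ⟨(Fact.out : p.Prime).ne_zero⟩
  refine eq_newtonOrder_of_exists (hζ.map_of_injective (FaithfulSMul.algebraMap_injective R K))
    hG hσ hχ (larsonOrder_le_newtonOrder hζ hχ hI) fun k hk c hc => ?_
  obtain ⟨x, hx, hxj, hxk⟩ := exists_mem_larsonOrder (K := K) (σ := σ) hζ hχ
    (s := Finset.range k) (fun m hm => (Finset.mem_range.mp hm).trans hk) (by simpa using hk) hk
    (by simp) (by simpa using hc)
  exact ⟨x, hx, by simpa using hxj, hxk⟩

end Larson

/-! ### Larson orders are Hopf orders -/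

section LarsonHopf

variable {p : ℕ} {R K : Type*} [CommRing R] [Field K] [Algebra R K] {G : Type*} [Group G] {ζ : R}
  {I : Ideal R} {σ : G}

theorem larsonOrder_fg [IsNoetherianRing R] (ζ : K) : (larsonOrder p ζ σ I).FG :=
  Submodule.fg_iSup _ fun _ => (IsNoetherian.noetherian _).map _

/-- A finitely generated `R`-submodule of a `K`-vector space spanning it over `K` is an order. -/
theorem isVectorSpaceOrder_of_fg [IsDedekindDomain R] [IsFractionRing R K] {V : Type*}
    [AddCommGroup V] [Module K V] [Module R V] [IsScalarTower R K V] {X : Submodule R V}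
    (hfg : X.FG) (hX : ∀ v : V, ∃ d : nonZeroDivisors R, (d : R) • v ∈ X) :
    IsVectorSpaceOrder K X where
  fg := hfg
  projective := by
    have : Module.Finite R X := Module.Finite.iff_fg.mpr hfg
    have : Module.IsTorsionFree R V := .trans_faithfulSMul R K V
    have : Module.FinitePresentation R X := Module.finitePresentation_of_finite R X
    exact Module.Flat.projective_of_finitePresentation
  isBaseChange := by
    refine (isLocalizedModule_iff_isBaseChange (nonZeroDivisors R) K X.subtype).mp ⟨?_, ?_, ?_⟩
    · intro d
      have hd : IsUnit (algebraMap R K d) := IsLocalization.map_units K d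
      have := hd.map (algebraMap K (Module.End K V))
      rw [Module.End.isUnit_iff] at this ⊢
      convert this using 1
      ext v
      simp
    · intro v
      obtain ⟨d, hd⟩ := hX v
      exact ⟨(⟨_, hd⟩, d), rfl⟩
    · intro x y h
      exact ⟨1, by rw [Subtype.coe_injective h]⟩

theorem exists_smul_mem_of_forall_of_mem [IsDomain R] [IsFractionRing R K] {X : Submodule R K[G]}
    (hX : ∀ g : G, MonoidAlgebra.of K G g ∈ X) (x : K[G]) :
    ∃ d : nonZeroDivisors R, (d : R) • x ∈ X := by
  induction x using MonoidAlgebra.induction_linear with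
  | zero => exact ⟨1, by simp⟩
  | add x y hx hy =>
    obtain ⟨d, hd⟩ := hx
    obtain ⟨e, he⟩ := hy
    refine ⟨d * e, ?_⟩
    rw [Submonoid.coe_mul, smul_add]
    refine add_mem ?_ ?_
    · rw [mul_comm, mul_smul]
      exact X.smul_mem _ hd
    · rw [mul_smul]
      exact X.smul_mem _ he
  | single g a =>
    obtain ⟨d, c, hc⟩ := IsLocalization.exists_integer_multiple (nonZeroDivisors R) a
    refine ⟨d, ?_⟩
    have : (d : R) • MonoidAlgebra.single g a = c • MonoidAlgebra.of K G g := by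
      rw [MonoidAlgebra.smul_single, ← hc, MonoidAlgebra.of_apply, MonoidAlgebra.smul_single,
        Algebra.smul_def c, mul_one]
    rw [this]
    exact X.smul_mem _ (hX g)

/-- The image of `X ⊗[R] X` in `K[G] ⊗[K] K[G]` is closed under multiplication if `X` is. -/
theorem mul_mem_span_tmul {X : Submodule R K[G]} (hX : ∀ x ∈ X, ∀ y ∈ X, x * y ∈ X)
    (s : K[G] ⊗[K] K[G])
    (hs : s ∈ Submodule.span R {t : K[G] ⊗[K] K[G] | ∃ a ∈ X, ∃ b ∈ X, t = a ⊗ₜ[K] b})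
    (t : K[G] ⊗[K] K[G])
    (ht : t ∈ Submodule.span R {t : K[G] ⊗[K] K[G] | ∃ a ∈ X, ∃ b ∈ X, t = a ⊗ₜ[K] b}) :
    s * t ∈ Submodule.span R {t : K[G] ⊗[K] K[G] | ∃ a ∈ X, ∃ b ∈ X, t = a ⊗ₜ[K] b} := by
  have h := Submodule.mul_mem_mul hs ht
  rw [Submodule.span_mul_span] at h
  refine Submodule.span_mono ?_ h
  rintro _ ⟨_, ⟨a, ha, b, hb, rfl⟩, _, ⟨c, hc, d, hd, rfl⟩, rfl⟩
  exact ⟨a * c, hX a ha c hc, b * d, hX b hb d hd, Algebra.TensorProduct.tmul_mul_tmul a c b d⟩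

theorem comul_larsonGenerator (ζ : K) :
    Coalgebra.comul (R := K) (larsonGenerator ζ σ) =
      larsonGenerator ζ σ ⊗ₜ[K] MonoidAlgebra.of K G σ + 1 ⊗ₜ[K] larsonGenerator ζ σ := by
  have h : Coalgebra.comul (R := K) (MonoidAlgebra.of K G σ) =
      MonoidAlgebra.of K G σ ⊗ₜ[K] MonoidAlgebra.of K G σ :=
    (MonoidAlgebra.isGroupLikeElem_of σ).comul_eq_tmul_self
  rw [larsonGenerator, map_smul, map_sub, h, Bialgebra.comul_one, Algebra.TensorProduct.one_def,
    ← TensorProduct.smul_tmul', TensorProduct.tmul_smul, ← smul_add, TensorProduct.sub_tmul,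
    TensorProduct.tmul_sub, sub_add_sub_cancel]

variable [Fact p.Prime]

theorem of_mem_larsonOrder [IsDomain R] [FaithfulSMul R K] (hζ : IsPrimitiveRoot ζ p)
    (hG : Nat.card G = p) (hσ : ∀ g : G, g ∈ Subgroup.zpowers σ) (hI : ζ - 1 ∈ I) (g : G) :
    MonoidAlgebra.of K G g ∈ larsonOrder p (algebraMap R K ζ) σ I := by
  have : NeZero p := ⟨(Fact.out : p.Prime).ne_zero⟩
  obtain ⟨χ, hχ⟩ := exists_character_of_generator
    (hζ.map_of_injective (FaithfulSMul.algebraMap_injective R K)) hG hσ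
  obtain ⟨n, rfl⟩ := exists_pow_eq_of_generator hG hσ g
  rw [larsonOrder_eq_newtonOrder hζ hG hσ hχ hI]
  exact of_pow_mem_newtonOrder hχ hI n

theorem isHopfOrder_larsonOrder [IsDedekindDomain R] [IsFractionRing R K]
    (hζ : IsPrimitiveRoot ζ p) (hG : Nat.card G = p)
    (hσ : ∀ g : G, g ∈ Subgroup.zpowers σ) (hI : ζ - 1 ∈ I) :
    IsHopfOrder K (larsonOrder p (algebraMap R K ζ) σ I) := by
  have : NeZero p := ⟨(Fact.out : p.Prime).ne_zero⟩
  have hζK := hζ.map_of_injective (FaithfulSMul.algebraMap_injective R K)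
  obtain ⟨χ, hχ⟩ := exists_character_of_generator hζK hG hσ
  have hH := larsonOrder_eq_newtonOrder hζ hG hσ hχ hI
  have hof := of_mem_larsonOrder (K := K) hζ hG hσ hI
  have hone : 1 ∈ larsonOrder p (algebraMap R K ζ) σ I := by
    have := hof 1
    rwa [map_one] at this
  have hmul : ∀ x ∈ larsonOrder p (algebraMap R K ζ) σ I,
      ∀ y ∈ larsonOrder p (algebraMap R K ζ) σ I, x * y ∈ larsonOrder p (algebraMap R K ζ) σ I := by
    rw [hH]
    exact fun x hx y hy => mul_mem_newtonOrder hx hy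
  refine ⟨isVectorSpaceOrder_of_fg (larsonOrder_fg _) (exists_smul_mem_of_forall_of_mem hof),
    hone, hmul, ?_, ?_, ?_⟩
  · -- The coproduct is multiplicative, so only the generators `c (σ - 1) / (ζ - 1)` matter.
    let T := Submodule.span R {t : K[G] ⊗[K] K[G] |
      ∃ a ∈ larsonOrder p (algebraMap R K ζ) σ I, ∃ b ∈ larsonOrder p (algebraMap R K ζ) σ I,
        t = a ⊗ₜ[K] b}
    have hT1 : 1 ∈ T := Submodule.subset_span ⟨1, hone, 1, hone, Algebra.TensorProduct.one_def⟩
    have hTg (c : R) (hc : c ∈ I) :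
        c • Coalgebra.comul (R := K) (larsonGenerator (algebraMap R K ζ) σ) ∈ T := by
      have hcg : c • larsonGenerator (algebraMap R K ζ) σ ∈
          larsonOrder p (algebraMap R K ζ) σ I := by
        have := larsonGenerator_smul_pow_mem (ζ := algebraMap R K ζ) (σ := σ)
          (Fact.out : p.Prime).one_lt (I := I) (c := c) (by simpa using hc)
        rwa [pow_one] at this
      rw [comul_larsonGenerator, smul_add]
      refine add_mem (Submodule.subset_span ⟨_, hcg, _, hof σ, TensorProduct.smul_tmul' ..⟩)
        (Submodule.subset_span ⟨1, hone, _, hcg, ?_⟩)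
      rw [TensorProduct.tmul_smul]
    have hle : larsonOrder p (algebraMap R K ζ) σ I ≤
        T.comap ((Coalgebra.comul (R := K) (A := K[G])).restrictScalars R) := by
      refine larsonOrder_le_iff.mpr fun i _ c hc => ?_
      have h := pow_smul_pow_mem hT1 (mul_mem_span_tmul hmul) hTg i c hc
      rw [← Bialgebra.comul_pow] at h
      rw [Submodule.mem_comap, map_smul]
      exact h
    exact hle
  · intro x hx
    rw [hH] at hx
    obtain ⟨c, hc⟩ := charTransform_mem_of_mem_newtonOrder hx 0
    exact ⟨c, by rw [hc, charTransform_zero_eq_counit]⟩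
  · have hle : larsonOrder p (algebraMap R K ζ) σ I ≤ (newtonOrder χ I).comap
        ((HopfAlgebra.antipode K (A := K[G])).restrictScalars R) := by
      refine larsonOrder_le_iff.mpr fun i _ c hc => ?_
      -- The antipode sends `σ` to `σ⁻¹ = σ ^ (p - 1)`.
      have h : HopfAlgebra.antipode K (c • larsonGenerator (algebraMap R K ζ) σ ^ i) =
          c • ((algebraMap R K ζ - 1)⁻¹ • (MonoidAlgebra.of K G (σ ^ (p - 1)) - 1)) ^ i := by
        refine charTransform_ext hζK hG hσ hχ fun j _ => ?_
        rw [charTransform_antipode hG, charTransform_integer_smul_apply,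
          charTransform_integer_smul_apply, map_pow, map_pow, Pi.pow_apply, Pi.pow_apply,
          charTransform_larsonGenerator hζ hχ, charTransform_smul_pow_sub_one hζ hχ]
      rw [Submodule.mem_comap, LinearMap.restrictScalars_apply, h]
      have hm : ∀ x ∈ newtonOrder χ I, ∀ y ∈ newtonOrder χ I, x * y ∈ newtonOrder χ I :=
        fun x hx y hy => mul_mem_newtonOrder hx hy
      exact pow_smul_pow_mem one_mem_newtonOrder hm
        (fun c hc => smul_pow_sub_one_mem_newtonOrder hζ hχ hI (p - 1) hc) i c hc
    rw [hH] at hle ⊢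
    exact hle

end LarsonHopf

/-! ### Hopf orders are Larson orders -/

section HopfOrder

variable {p : ℕ} {R K : Type*} [CommRing R] [Field K] [Algebra R K] {G : Type*} [Group G]

/-- Fields of fractions of noetherian integrally closed domains contain no new almost integral
elements. -/
theorem exists_algebraMap_eq_of_forall_pow_mem [IsNoetherianRing R] [IsDomain R]
    [IsIntegrallyClosed R] [IsFractionRing R K] {M : Submodule R K} (hM : M.FG) {y : K}
    (hy : ∀ n : ℕ, y ^ n ∈ M) : ∃ c : R, algebraMap R K c = y := by
  refine IsIntegrallyClosed.algebraMap_eq_of_integral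
    (IsIntegral.of_mem_of_fg (Algebra.adjoin R {y}) ?_ y (Algebra.self_mem_adjoin_singleton R y))
  have : IsNoetherian R M := isNoetherian_of_fg_of_noetherian M hM
  refine Submodule.FG.of_le hM ?_
  rw [Algebra.adjoin_eq_span, Submodule.span_le]
  rintro _ hz
  obtain ⟨n, rfl⟩ := Submonoid.mem_closure_singleton.mp hz
  exact hy n

variable {X : Submodule R K[G]}

theorem IsHopfOrder.pow_mem (hX : IsHopfOrder K X) {x : K[G]} (hx : x ∈ X) (n : ℕ) : x ^ n ∈ X := by
  induction n with
  | zero => simpa using hX.one_mem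
  | succ n ih =>
    rw [pow_succ]
    exact hX.mul_mem _ ih _ hx

theorem IsHopfOrder.exists_smul_mem [IsDomain R] [IsFractionRing R K] (hX : IsHopfOrder K X)
    (x : K[G]) : ∃ d : nonZeroDivisors R, (d : R) • x ∈ X := by
  have := (isLocalizedModule_iff_isBaseChange (nonZeroDivisors R) K X.subtype).mpr hX.isBaseChange
  obtain ⟨⟨y, d⟩, h⟩ := IsLocalizedModule.surj (nonZeroDivisors R) X.subtype x
  refine ⟨d, ?_⟩
  have e : (d : R) • x = y := h
  rw [e]
  exact y.2

/-- Characters take integral values on a Hopf order. -/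
theorem IsHopfOrder.exists_algebraMap_eq_charTransform [IsDedekindDomain R] [IsFractionRing R K]
    (hX : IsHopfOrder K X) (χ : G →* K) {x : K[G]} (hx : x ∈ X) (j : ℕ) :
    ∃ c : R, algebraMap R K c = charTransform χ x j := by
  refine exists_algebraMap_eq_of_forall_pow_mem (hX.fg.map
    ((LinearMap.proj j ∘ₗ (charTransform χ).toLinearMap).restrictScalars R)) fun n => ?_
  exact ⟨x ^ n, hX.pow_mem hx n, by simp⟩

/-- A Hopf order contains the group elements. The group elements are the algebra homomorphisms from
the convolution algebra dual to `K[G]` to `K`, so they take integral values on the order dual to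
`X`; expanding a group element in a dual basis of the projective module `X` gives the claim. -/
theorem IsHopfOrder.of_mem [IsDedekindDomain R] [IsFractionRing R K]
    (hX : IsHopfOrder K X) (g : G) :
    MonoidAlgebra.of K G g ∈ X := by
  -- Convolution powers of a functional that is integral on `X`.
  have hpow (φ : K[G] →ₗ[K] K) (hφ : ∀ x ∈ X, ∃ c : R, algebraMap R K c = φ x) (n : ℕ) :
      ∃ ψ : K[G] →ₗ[K] K, (∀ x ∈ X, ψ x ∈ (algebraMap R K).range) ∧
        ψ (MonoidAlgebra.of K G g) = φ (MonoidAlgebra.of K G g) ^ n := by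
    induction n with
    | zero =>
      exact ⟨Coalgebra.counit, hX.counit_mem, by simp⟩
    | succ n ih =>
      obtain ⟨ψ, hψ, hψg⟩ := ih
      refine ⟨LinearMap.mul' K K ∘ₗ TensorProduct.map ψ φ ∘ₗ Coalgebra.comul, fun x hx => ?_, ?_⟩
      · have h := hX.comul_mem x hx
        rw [LinearMap.comp_apply, LinearMap.comp_apply]
        generalize Coalgebra.comul (R := K) x = t at h
        induction h using Submodule.span_induction with
        | mem t ht =>
          obtain ⟨a, ha, b, hb, rfl⟩ := ht
          rw [TensorProduct.map_tmul, LinearMap.mul'_apply]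
          exact (algebraMap R K).range.mul_mem (hψ a ha) (hφ b hb)
        | zero => simp
        | add s t _ _ hs ht =>
          rw [map_add, map_add]
          exact add_mem hs ht
        | smul c t _ ht =>
          rw [← algebraMap_smul K c t, map_smul, map_smul, smul_eq_mul]
          exact (algebraMap R K).range.mul_mem ⟨c, rfl⟩ ht
      · rw [pow_succ, ← hψg, LinearMap.comp_apply, LinearMap.comp_apply,
          (MonoidAlgebra.isGroupLikeElem_of g).comul_eq_tmul_self, TensorProduct.map_tmul,
          LinearMap.mul'_apply]
  have hint (φ : K[G] →ₗ[K] K) (hφ : ∀ x ∈ X, ∃ c : R, algebraMap R K c = φ x) :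
      ∃ c : R, algebraMap R K c = φ (MonoidAlgebra.of K G g) := by
    obtain ⟨d, hd⟩ := hX.exists_smul_mem (MonoidAlgebra.of K G g)
    have hd0 : algebraMap R K d ≠ 0 := IsFractionRing.to_map_ne_zero_of_mem_nonZeroDivisors d.2
    refine exists_algebraMap_eq_of_forall_pow_mem
      (Submodule.fg_span_singleton (R := R) (algebraMap R K d)⁻¹) fun n => ?_
    obtain ⟨ψ, hψ, hψg⟩ := hpow φ hφ n
    obtain ⟨c, hc⟩ := hψ _ hd
    rw [← algebraMap_smul K, map_smul, hψg, smul_eq_mul] at hc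
    refine Submodule.mem_span_singleton.mpr ⟨c, ?_⟩
    rw [Algebra.smul_def, hc]
    field_simp
  have : Module.Finite R X := Module.Finite.iff_fg.mpr hX.fg
  have := hX.projective
  obtain ⟨n, f, φ, -, -, hfφ⟩ := Module.Finite.exists_comp_eq_id_of_projective R X
  -- The coordinate functionals, extended to `K[G]`.
  let Φ (i : Fin n) : K[G] →ₗ[K] K :=
    hX.isBaseChange.lift (Algebra.linearMap R K ∘ₗ LinearMap.proj i ∘ₗ φ)
  have hΦ (i : Fin n) (x : X) : Φ i x = algebraMap R K (φ x i) := hX.isBaseChange.lift_eq _ x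
  have hexp (x : K[G]) : x = ∑ i, Φ i x • (f (Pi.single i 1) : K[G]) := by
    refine hX.isBaseChange.inductionOn x (motive := fun x =>
      x = ∑ i, Φ i x • (f (Pi.single i 1) : K[G])) (by simp) (fun m => ?_) (fun s y hy => ?_)
      (fun y z hy hz => ?_)
    · have h : m = f (φ m) := (LinearMap.congr_fun hfφ m).symm
      rw [Submodule.subtype_apply]
      simp only [hΦ, algebraMap_smul]
      conv_lhs => rw [h, pi_eq_sum_univ' (φ m), map_sum]
      simp [Pi.single]
    · conv_lhs => rw [hy, Finset.smul_sum]
      simp [mul_smul]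
    · conv_lhs => rw [hy, hz, ← Finset.sum_add_distrib]
      simp [add_smul]
  rw [hexp (MonoidAlgebra.of K G g)]
  refine sum_mem fun i _ => ?_
  obtain ⟨c, hc⟩ := hint (Φ i) fun x hx => ⟨_, (hΦ i ⟨x, hx⟩).symm⟩
  rw [← hc, algebraMap_smul]
  exact X.smul_mem c (f (Pi.single i 1)).2

/-- The functional `x ↦ χ(x) - ε(x)`. -/
noncomputable def charSubCounit (χ : G →* K) : K[G] →ₗ[K] K :=
  LinearMap.proj 1 ∘ₗ (charTransform χ).toLinearMap -
    LinearMap.proj 0 ∘ₗ (charTransform χ).toLinearMap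

theorem charSubCounit_apply (χ : G →* K) (x : K[G]) :
    charSubCounit χ x = charTransform χ x 1 - charTransform χ x 0 := rfl

/-- The ideal of `R` of the values `χ(x) - ε(x)` for `x ∈ X`. -/
noncomputable def differenceIdeal (χ : G →* K) (X : Submodule R K[G]) : Ideal R :=
  (X.map ((charSubCounit χ).restrictScalars R)).comap (Algebra.linearMap R K)

variable {χ : G →* K}

theorem mem_differenceIdeal {c : R} : c ∈ differenceIdeal χ X ↔
    ∃ x ∈ X, charTransform χ x 1 - charTransform χ x 0 = algebraMap R K c := Iff.rfl

/-- Differences of transforms are obtained by convolving with `χ - ε`. As `Δ(X) ⊆ X ⊗ X`, this maps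
`X` to `I X` for `I` the difference ideal of `X`. -/
theorem IsHopfOrder.exists_charTransform_eq_fwdDiff [IsDedekindDomain R] [IsFractionRing R K]
    (hX : IsHopfOrder K X) {x : K[G]} (hx : x ∈ X) :
    ∃ y ∈ differenceIdeal χ X • X, charTransform χ y = fwdDiff 1 (charTransform χ x) := by
  let θ : K[G] ⊗[K] K[G] →ₗ[K] K[G] := TensorProduct.lid K K[G] ∘ₗ (charSubCounit χ).rTensor K[G]
  have hθ (a b : K[G]) : θ (a ⊗ₜ b) = charSubCounit χ a • b := by simp [θ]
  refine ⟨θ (Coalgebra.comul (R := K) x), ?_, ?_⟩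
  · have h := hX.comul_mem x hx
    generalize Coalgebra.comul (R := K) x = t at h
    induction h using Submodule.span_induction with
    | mem t ht =>
      obtain ⟨a, ha, b, hb, rfl⟩ := ht
      obtain ⟨c, hc⟩ := hX.exists_algebraMap_eq_charTransform χ ha 1
      obtain ⟨d, hd⟩ := hX.exists_algebraMap_eq_charTransform χ ha 0
      have hcd : charSubCounit χ a = algebraMap R K (c - d) := by
        rw [charSubCounit_apply, map_sub, hc, hd]
      rw [hθ, hcd, algebraMap_smul]
      exact Submodule.smul_mem_smul (mem_differenceIdeal.mpr ⟨a, ha, hcd⟩) hb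
    | zero => simp
    | add s t _ _ hs ht =>
      rw [map_add]
      exact add_mem hs ht
    | smul c t _ ht =>
      rw [← algebraMap_smul K c t, map_smul, algebraMap_smul]
      exact Submodule.smul_mem _ c ht
  · clear hx
    ext j
    induction x using MonoidAlgebra.induction_linear with
    | zero => simp [fwdDiff]
    | add x y hx hy => simp [hx, hy]
    | single g a =>
      simp [hθ, charSubCounit_apply, fwdDiff, pow_succ]
      ring

/-- Each difference operator gains a factor from the difference ideal. -/
theorem IsHopfOrder.le_newtonOrder [IsDedekindDomain R] [IsFractionRing R K]
    (hX : IsHopfOrder K X) : X ≤ newtonOrder χ (differenceIdeal χ X) := by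
  intro x hx i
  induction i generalizing x with
  | zero =>
    intro j
    obtain ⟨c, hc⟩ := hX.exists_algebraMap_eq_charTransform χ hx j
    exact ⟨c, by simp, hc⟩
  | succ i ih =>
    intro j
    obtain ⟨y, hy, hyx⟩ := hX.exists_charTransform_eq_fwdDiff (χ := χ) hx
    rw [Function.iterate_succ_apply, ← hyx]
    clear hyx
    induction hy using Submodule.smul_induction_on' with
    | smul c hc b hb =>
      rw [charTransform_integer_smul, fwdDiff_iter_const_smul, Pi.smul_apply, Algebra.smul_def]
      have h1 : algebraMap R K c ∈ powImage (differenceIdeal χ X) 1 := ⟨c, by simpa using hc, rfl⟩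
      exact powImage_antitone (by omega) (mul_mem_powImage h1 (ih hb j))
    | add a _ b _ ha hb =>
      rw [map_add, fwdDiff_iter_add]
      exact add_mem ha hb

theorem IsHopfOrder.exists_charTransform_eq_add [IsDedekindDomain R] [IsFractionRing R K]
    (hX : IsHopfOrder K X) {x : K[G]} (hx : x ∈ X) (n : ℕ) :
    ∃ y ∈ X, ∀ j, charTransform χ y j = charTransform χ x (j + n) := by
  induction n with
  | zero => exact ⟨x, hx, fun _ => rfl⟩
  | succ n ih =>
    obtain ⟨y, hy, hyx⟩ := ih
    obtain ⟨z, hz, hzy⟩ := hX.exists_charTransform_eq_fwdDiff (χ := χ) hy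
    refine ⟨z + y, add_mem (Submodule.smul_le_right hz) hy, fun j => ?_⟩
    rw [map_add, hzy, Pi.add_apply, fwdDiff, sub_add_cancel, hyx, Nat.add_right_comm, Nat.add_assoc]

/-- Each element of the difference ideal is the difference of the values at `k` and `m` of an
element of `X`. With `a = k - m` and `a b ≡ 1` modulo `p`, the difference of `f` at `1` and `0` is
the sum of its differences at `a (i + 1)` and `a i` for `i < b`, and each of these is the difference
at `k` and `m` of a translate of `f`. -/
theorem IsHopfOrder.exists_charTransform_eq_zero_and_eq [IsDedekindDomain R] [IsFractionRing R K]
    [Fact p.Prime] (hG : Nat.card G = p) (hX : IsHopfOrder K X) {k m : ℕ} (hk : k < p) (hm : m < k)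
    {c : R} (hc : c ∈ differenceIdeal χ X) :
    ∃ x ∈ X, charTransform χ x m = 0 ∧ charTransform χ x k = algebraMap R K c := by
  have hp : p.Prime := Fact.out
  have : NeZero p := ⟨hp.ne_zero⟩
  obtain ⟨f, hf, hfc⟩ := mem_differenceIdeal.mp hc
  obtain ⟨a, rfl⟩ := Nat.exists_eq_add_of_le hm.le
  obtain ⟨b, -, hb⟩ := Nat.exists_mul_mod_eq_one_of_coprime
    (Nat.coprime_of_lt_prime (n := a) (by omega) (by omega) hp).symm hp.one_lt
  choose g hgX hg using fun i => hX.exists_charTransform_eq_add (χ := χ) hf (a * i + (p - m))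
  have hper (j : ℕ) : charTransform χ f (j + p) = charTransform χ f j := by
    simpa using charTransform_periodic hG χ f j 1
  have h1 (i : ℕ) : charTransform χ (g i) m = charTransform χ f (a * i) := by
    rw [hg, show m + (a * i + (p - m)) = a * i + p by omega, hper]
  have h2 (i : ℕ) : charTransform χ (g i) (m + a) = charTransform χ f (a * (i + 1)) := by
    rw [hg, show m + a + (a * i + (p - m)) = a * (i + 1) + p by rw [mul_add]; omega, hper]
  have hS : ∑ i ∈ Finset.range b, g i ∈ X := sum_mem fun i _ => hgX i
  obtain ⟨r, hr⟩ := hX.exists_algebraMap_eq_charTransform χ hS m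
  have hdiff : charTransform χ (∑ i ∈ Finset.range b, g i) (m + a) -
      charTransform χ (∑ i ∈ Finset.range b, g i) m = algebraMap R K c := by
    simp only [map_sum, Finset.sum_apply, h1, h2, ← Finset.sum_sub_distrib]
    rw [Finset.sum_range_sub fun i => charTransform χ f (a * i), ← hfc, mul_zero]
    congr 1
    conv_lhs => rw [← Nat.mod_add_div (a * b) p, hb]
    exact charTransform_periodic hG χ f 1 _
  -- The value at `m` is integral, so it can be subtracted as a constant.
  refine ⟨∑ i ∈ Finset.range b, g i - r • 1, sub_mem hS (X.smul_mem r hX.one_mem), ?_, ?_⟩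
  · rw [map_sub, Pi.sub_apply, charTransform_integer_smul_apply, map_one, Pi.one_apply, mul_one,
      hr, sub_self]
  · rw [map_sub, Pi.sub_apply, charTransform_integer_smul_apply, map_one, Pi.one_apply, mul_one,
      hr, hdiff]

theorem IsHopfOrder.eq_newtonOrder [IsDedekindDomain R] [IsFractionRing R K]
    [Fact p.Prime] {ζ : R} (hζ : IsPrimitiveRoot ζ p) (hG : Nat.card G = p) {σ : G}
    (hσ : ∀ g : G, g ∈ Subgroup.zpowers σ) (hχ : χ σ = algebraMap R K ζ) (hX : IsHopfOrder K X) :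
    X = newtonOrder χ (differenceIdeal χ X) := by
  have : NeZero p := ⟨(Fact.out : p.Prime).ne_zero⟩
  refine eq_newtonOrder_of_exists (hζ.map_of_injective (FaithfulSMul.algebraMap_injective R K))
    hG hσ hχ hX.le_newtonOrder fun k hk => ?_
  -- Products of elements vanishing at `0, …, n - 1` one at a time, with prescribed values at `k`.
  suffices h : ∀ n ≤ k, ∀ c ∈ differenceIdeal χ X ^ n, ∃ x ∈ X,
      (∀ j < n, charTransform χ x j = 0) ∧ charTransform χ x k = algebraMap R K c from h k le_rfl
  intro n
  induction n with
  | zero =>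
    refine fun _ c _ => ⟨c • 1, X.smul_mem c hX.one_mem, by simp, ?_⟩
    rw [charTransform_integer_smul_apply, map_one, Pi.one_apply, mul_one]
  | succ n ih =>
    intro hn c hc
    rw [pow_succ] at hc
    induction hc using Submodule.mul_induction_on' with
    | mem_mul_mem a ha b hb =>
      obtain ⟨x, hx, hxj, hxk⟩ := ih (by omega) a ha
      obtain ⟨y, hy, hyn, hyk⟩ := hX.exists_charTransform_eq_zero_and_eq hG hk hn hb
      refine ⟨x * y, hX.mul_mem x hx y hy, fun j hj => ?_, ?_⟩
      · rw [map_mul, Pi.mul_apply]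
        rcases Nat.lt_succ_iff_lt_or_eq.mp hj with hj | rfl
        · rw [hxj j hj, zero_mul]
        · rw [hyn, mul_zero]
      · rw [map_mul, Pi.mul_apply, hxk, hyk, map_mul]
    | add a _ b _ ha hb =>
      obtain ⟨x, hx, hxj, hxk⟩ := ha
      obtain ⟨y, hy, hyj, hyk⟩ := hb
      refine ⟨x + y, add_mem hx hy, fun j hj => ?_, ?_⟩
      · rw [map_add, Pi.add_apply, hxj j hj, hyj j hj, add_zero]
      · rw [map_add, Pi.add_apply, hxk, hyk, map_add]

theorem IsHopfOrder.exists_eq_larsonOrder [IsDedekindDomain R] [IsFractionRing R K]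
    [Fact p.Prime] {ζ : R} (hζ : IsPrimitiveRoot ζ p) (hG : Nat.card G = p) {σ : G}
    (hσ : ∀ g : G, g ∈ Subgroup.zpowers σ) (hX : IsHopfOrder K X) :
    ∃ I : Ideal R, ζ - 1 ∈ I ∧ X = larsonOrder p (algebraMap R K ζ) σ I := by
  have : NeZero p := ⟨(Fact.out : p.Prime).ne_zero⟩
  obtain ⟨χ, hχ⟩ := exists_character_of_generator
    (hζ.map_of_injective (FaithfulSMul.algebraMap_injective R K)) hG hσ
  have hI : ζ - 1 ∈ differenceIdeal χ X :=
    mem_differenceIdeal.mpr ⟨_, hX.of_mem σ, by simp [hχ]⟩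
  exact ⟨_, hI, (hX.eq_newtonOrder hζ hG hσ hχ).trans
    (larsonOrder_eq_newtonOrder hζ hG hσ hχ hI).symm⟩

end HopfOrder

/-! ### Integrals and directness of the sum -/

section Integrals

variable {p : ℕ} [Fact p.Prime] {R K : Type*} [CommRing R] [Field K] [Algebra R K]
  {G : Type*} [Group G]

/-- The averaging idempotent transforms to the indicator function of `0`. -/
theorem charTransform_inv_smul_sum_pow {ζ : K} (hζ : IsPrimitiveRoot ζ p) {σ : G} {χ : G →* K}
    (hχ : χ σ = ζ) {j : ℕ} (hj : j < p) :
    charTransform χ ((p : K)⁻¹ • ∑ i ∈ Finset.range p, MonoidAlgebra.of K G σ ^ i) j =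
      if j = 0 then 1 else 0 := by
  have hp : p.Prime := Fact.out
  have : NeZero p := ⟨hp.ne_zero⟩
  have h : charTransform χ ((p : K)⁻¹ • ∑ i ∈ Finset.range p, MonoidAlgebra.of K G σ ^ i) j =
      (p : K)⁻¹ * ∑ i ∈ Finset.range p, (ζ ^ j) ^ i := by
    rw [map_smul, Pi.smul_apply, map_sum, Finset.sum_apply, smul_eq_mul]
    simp only [map_pow, Pi.pow_apply, charTransform_of, hχ]
  rw [h]
  split_ifs with h0
  · have : NeZero (p : K) := hζ.neZero'
    simp [h0, NeZero.ne (p : K)]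
  · rw [(hζ.pow_of_coprime j (Nat.coprime_of_lt_prime h0 hj hp).symm).geom_sum_eq_zero hp.one_lt,
      mul_zero]

theorem leftIntegrals_larsonOrder [IsDomain R] [FaithfulSMul R K] {ζ : R}
    (hζ : IsPrimitiveRoot ζ p) (hG : Nat.card G = p) {σ : G}
    (hσ : ∀ g : G, g ∈ Subgroup.zpowers σ) {I : Ideal R} (hI : ζ - 1 ∈ I) :
    leftIntegrals K (larsonOrder p (algebraMap R K ζ) σ I) = idealSMulVec (I ^ (p - 1))
      ((p : K)⁻¹ • ∑ i ∈ Finset.range p, MonoidAlgebra.of K G σ ^ i) := by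
  have hp : p.Prime := Fact.out
  have : NeZero p := ⟨hp.ne_zero⟩
  have hζK := hζ.map_of_injective (FaithfulSMul.algebraMap_injective R K)
  obtain ⟨χ, hχ⟩ := exists_character_of_generator hζK hG hσ
  have hv {j : ℕ} (hj : j < p) := charTransform_inv_smul_sum_pow hζK hχ hj
  have hH := larsonOrder_eq_newtonOrder hζ hG hσ hχ hI
  generalize (p : K)⁻¹ • ∑ i ∈ Finset.range p, MonoidAlgebra.of K G σ ^ i = v at hv ⊢
  -- An element whose transform vanishes at `1, …, p - 1` is the multiple of `v` by its counit.
  have huniq {t : K[G]} {c : R} (ht : ∀ j, 0 < j → j < p → charTransform χ t j = 0)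
      (h0 : charTransform χ t 0 = algebraMap R K c) : t = c • v := by
    refine charTransform_ext hζK hG hσ hχ fun j hj => ?_
    rw [charTransform_integer_smul_apply, hv hj]
    rcases Nat.eq_zero_or_pos j with rfl | hj0
    · simpa using h0
    · simpa [hj0.ne'] using ht j hj0 hj
  ext t
  constructor
  · rintro ⟨ht, hint⟩
    have hvan (j : ℕ) (hj0 : 0 < j) (hj : j < p) : charTransform χ t j = 0 := by
      have h := congr_fun (congr_arg (charTransform χ)
        (hint _ (of_mem_larsonOrder hζ hG hσ hI σ))) j
      rw [map_mul, Pi.mul_apply, charTransform_of, hχ, map_smul, Pi.smul_apply,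
        ← charTransform_zero_eq_counit χ, charTransform_of, pow_zero, one_smul] at h
      by_contra h0
      exact hζK.pow_ne_one_of_pos_of_lt hj0.ne' hj (mul_eq_right₀ h0 |>.mp h)
    -- The `(p - 1)`-st difference at `1` is the value at `p`, which is the counit.
    rw [hH] at ht
    have hd := ht (p - 1) 1
    rw [fwdDiff_iter_eq_of_forall_eq_zero fun i hi => hvan (1 + i) (by omega) (by omega),
      show 1 + (p - 1) = 0 + p * 1 by have := hp.one_lt; omega, charTransform_periodic hG] at hd
    obtain ⟨c, hc, hct⟩ := exists_of_mem_powImage hd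
    exact ⟨c, hc, (huniq hvan hct.symm).symm⟩
  · rintro ⟨c, hc, rfl⟩
    obtain ⟨x, hx, hxj, hx0⟩ := exists_mem_larsonOrder (K := K) (I := I) (c := c) hζ hχ
      (s := Finset.Ico 1 p) (fun m hm => (Finset.mem_Ico.mp hm).2)
      (by have := hp.one_lt; rw [Nat.card_Ico]; omega) hp.pos (by simp) (by simpa using hc)
    have hxv : x = c • v := huniq (fun j h1 h2 => hxj j (Finset.mem_Ico.mpr ⟨h1, h2⟩)) hx0
    rw [LinearMap.toSpanSingleton_apply]
    refine ⟨hxv ▸ hx, fun h _ => charTransform_ext hζK hG hσ hχ fun j hj => ?_⟩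
    rw [← charTransform_zero_eq_counit χ, map_mul, map_smul (charTransform χ), Pi.mul_apply,
      Pi.smul_apply, charTransform_integer_smul_apply, hv hj, smul_eq_mul]
    split_ifs with h0
    · rw [h0]
    · simp

/-- The powers of `(σ - 1) / (ζ - 1)` below the `p`-th are linearly independent: on the `p`
characters this element takes distinct values. -/
theorem linearIndependent_larsonGenerator_pow {ζ : K} (hζ : IsPrimitiveRoot ζ p) {σ : G}
    {χ : G →* K} (hχ : χ σ = ζ) :
    LinearIndependent K fun i : Fin p => larsonGenerator ζ σ ^ (i : ℕ) := by
  have hζ1 : ζ - 1 ≠ 0 := sub_ne_zero.mpr (hζ.ne_one (Fact.out : p.Prime).one_lt)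
  let q (j : Fin p) : K := (ζ - 1)⁻¹ * (ζ ^ (j : ℕ) - 1)
  have hq : Function.Injective q := fun i j hij => by
    have h := sub_left_injective (mul_left_cancel₀ (inv_ne_zero hζ1) hij)
    exact Fin.ext (hζ.pow_inj i.2 j.2 h)
  rw [Fintype.linearIndependent_iff]
  intro a ha
  refine congr_fun (Matrix.eq_zero_of_forall_index_sum_pow_mul_eq_zero hq fun j => ?_)
  have h := congr_fun (congr_arg (charTransform χ) ha) j
  simpa [larsonGenerator, hχ, q, mul_comm] using h

theorem iSupIndep_idealSMulVec_larsonGenerator_pow {ζ : K} (hζ : IsPrimitiveRoot ζ p) {σ : G}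
    {χ : G →* K} (hχ : χ σ = ζ) (I : Ideal R) :
    iSupIndep fun i : Fin p => idealSMulVec (I ^ (i : ℕ)) (larsonGenerator ζ σ ^ (i : ℕ)) := by
  rw [iSupIndep_iff_finsetSum_eq_zero_imp_eq_zero]
  intro s v hv h0 i hi
  choose! c hcI hc using hv
  have hli := linearIndependent_iff'.mp (linearIndependent_larsonGenerator_pow hζ hχ) s
    (fun i => algebraMap R K (c i)) ?_ i hi
  · rw [← hc i hi, LinearMap.toSpanSingleton_apply, ← algebraMap_smul K, hli, zero_smul]
  · rw [← h0]
    refine Finset.sum_congr rfl fun i hi => ?_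
    rw [← hc i hi, LinearMap.toSpanSingleton_apply, algebraMap_smul]

end Integrals

/-! ### Rings of integers of number fields -/

theorem larsonSummand_eq_idealSMulVec {K : Type*} [Field K] {G : Type*} [Group G] (ζ : K) (σ : G)
    (I : Ideal (𝓞 K)) (i : ℕ) :
    larsonSummand ζ σ I i = idealSMulVec (I ^ i) (larsonGenerator ζ σ ^ i) := by
  rw [larsonSummand, larsonGenerator, smul_pow, inv_pow]

theorem globalLarsonOrder_eq_larsonOrder {K : Type*} [Field K] {G : Type*} [Group G] (p : ℕ) (ζ : K)
    (σ : G) (I : Ideal (𝓞 K)) : globalLarsonOrder p ζ σ I = larsonOrder p ζ σ I := by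
  simp only [globalLarsonOrder, larsonOrder, larsonSummand_eq_idealSMulVec]

theorem mainTheorem6 {p : ℕ} [Fact p.Prime] {K : Type*} [Field K] [NumberField K]
    {ζ : K} (hζ : IsPrimitiveRoot ζ p) {G : Type*} [Group G] (hG : Nat.card G = p)
    {σ : G} (hσ : ∀ g : G, g ∈ Subgroup.zpowers σ) :
    (∀ X : Submodule (𝓞 K) K[G], IsHopfOrder K X →
      ∃ I : Ideal (𝓞 K), hζ.toInteger - 1 ∈ I ∧ X = globalLarsonOrder p ζ σ I) ∧
    (∀ I : Ideal (𝓞 K), hζ.toInteger - 1 ∈ I →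
      iSupIndep (fun i : Fin p => larsonSummand ζ σ I i) ∧
      IsHopfOrder K (globalLarsonOrder p ζ σ I) ∧
      leftIntegrals K (globalLarsonOrder p ζ σ I) =
        idealSMulVec (I ^ (p - 1))
          ((p : K)⁻¹ • ∑ i ∈ Finset.range p, MonoidAlgebra.of K G σ ^ i)) := by
  have : NeZero p := ⟨(Fact.out : p.Prime).ne_zero⟩
  have hη : IsPrimitiveRoot hζ.toInteger p := hζ.toInteger_isPrimitiveRoot
  have hηζ : algebraMap (𝓞 K) K hζ.toInteger = ζ := rfl
  obtain ⟨χ, hχ⟩ := exists_character_of_generator hζ hG hσ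
  refine ⟨fun X hX => ?_, fun I hI => ⟨?_, ?_, ?_⟩⟩
  · obtain ⟨I, hI, hXI⟩ := hX.exists_eq_larsonOrder hη hG hσ
    exact ⟨I, hI, by rw [hXI, hηζ, globalLarsonOrder_eq_larsonOrder]⟩
  · simp only [larsonSummand_eq_idealSMulVec]
    exact iSupIndep_idealSMulVec_larsonGenerator_pow hζ hχ I
  · rw [globalLarsonOrder_eq_larsonOrder, ← hηζ]
    exact isHopfOrder_larsonOrder hη hG hσ hI
  · rw [globalLarsonOrder_eq_larsonOrder, ← hηζ]
    exact leftIntegrals_larsonOrder hη hG hσ hI
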